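/- Let $G$ be a connected, locally finite simple graph, finite or infinite, that is chordal, i.e. contains no induced cycle of length greater than $3$. A \emph{clique} of $G$ is an inclusion-maximal complete set of vertices; the \emph{clique graph} $\mathcal K_G$ has the cliques as vertices and an edge $KL$ for each pair of distinct cliques with $K\cap L\neq\emptyset$. A \emph{clique tree} of $G$ is a spanning tree $T$ of $\mathcal K_G$ such that, for every vertex $v$ of $G$, the subgraph of $T$ induced by the set of cliques containing $v$ is a tree. For a complete (possibly empty) set $C$ of vertices put $F(C):=\{K \text{ a clique}: C\subseteq K\}$; the sets of this form are the \emph{clique families} of $G$. For a clique family $F$, let $\sim_F$ be the equivalence relation on $F$ whose classes are the connected components of the graph with vertex set $F$ and with those edges $KL$ of $\mathcal K_G$, $K,L\in F$, for which $F(K\cap L)\subsetneq F$. Let $\mathcal C(F)$ be the multigraph obtained from the graph with vertex set $F$ and with those edges $KL$ of $\mathcal K_G$, $K,L\in F$, for which $F(K\cap L)=F$ by contracting each $\sim_F$-class to a single vertex, keeping loops and parallel edges; each edge of $\mathcal C(F)$ is labelled by the edge $KL$ from which it comes. Spanning trees of $\mathcal C(F)$ have neither loops nor parallel edges, and are distinguished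 by the labels of their edges. Theorem. The edge labels of the multigraphs $\mathcal C(F)$, with $F$ ranging over all clique families, partition the edge set of $\mathcal K_G$. Splitting edge sets along this partition is a bijection between the set of clique trees of $G$ and $$\prod_{F\ \text{clique family of } G}\{\text{spanning trees of } \mathcal C(F)\}:$$ it maps a clique tree $T$ to the family $(T_F)_F$, where $T_F$ is the spanning tree of $\mathcal C(F)$ whose edges are those labelled by edges of $T$; its inverse maps a family $(T_F)_F$ to the clique tree whose edge set is the union over all $F$ of the sets of edge labels of $T_F$. -/

import Mathlib

namespace CliqueTree

universe u v

/-! ### Multigraphs -/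

section Multigraph

variable {α : Type u} {β : Type v}

/-- The multigraph obtained by contracting every class of the equivalence relation `r` to a single
vertex.  Edges keep their labels; an edge inside a class becomes a loop, and edges between the same
two classes become parallel edges. -/
def contract (M : Graph α β) (r : Setoid α) : Graph (Quotient r) β :=
  M.map (Quotient.mk r)

/-- `H` is a spanning tree of the multigraph `M`: a submultigraph with the same vertex set that
has neither loops nor parallel edges and whose underlying simple graph is connected and acyclic. -/
def IsSpanningTree (H M : Graph α β) : Prop :=
  H.IsSpanningSubgraph M ∧ H.Simple ∧ H.toSimpleGraph.IsTree

/-- The set of spanning trees of a multigraph, as a type. -/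
abbrev SpanningTree (M : Graph α β) : Type (max u v) :=
  {H : Graph α β // IsSpanningTree H M}

end Multigraph

/-! ### Cliques, the clique graph and clique trees -/

section Cliques

variable {V : Type u}

/-- `G` contains no induced cycle of length greater than `3`. -/
def IsChordal (G : SimpleGraph V) : Prop :=
  ∀ n : ℕ, 3 < n → IsEmpty (SimpleGraph.cycleGraph n ↪g G)

/-- The cliques of `G`: the inclusion-maximal complete sets of vertices.  (`SimpleGraph.IsClique`
is completeness of a vertex set, without maximality.) -/
abbrev Clique (G : SimpleGraph V) : Type u :=
  {K : Set V // Maximal (fun W : Set V => G.IsClique W) K}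

/-- The clique graph: distinct cliques are adjacent if and only if they intersect. -/
def cliqueGraph (G : SimpleGraph V) : SimpleGraph (Clique G) where
  Adj K L := K ≠ L ∧ (K.1 ∩ L.1).Nonempty
  symm := ⟨fun _ _ h => ⟨h.1.symm, by rw [Set.inter_comm]; exact h.2⟩⟩
  loopless := ⟨fun _ h => h.1 rfl⟩

/-- The set of all cliques containing the vertex set `C`. -/
def generatedFamily (G : SimpleGraph V) (C : Set V) : Set (Clique G) :=
  {K | C ⊆ K.1}

/-- The clique families of `G`: the sets of cliques generated by some complete vertex set
(the empty set is complete, and generates the family of all cliques). -/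
abbrev CliqueFamily (G : SimpleGraph V) : Type u :=
  {F : Set (Clique G) // ∃ C : Set V, G.IsClique C ∧ generatedFamily G C = F}

/-- `T` is a clique tree of `G`: a spanning tree of the clique graph that induces a tree on the
set of cliques containing `x`, for every vertex `x`. -/
def IsCliqueTree (G : SimpleGraph V) (T : SimpleGraph (Clique G)) : Prop :=
  T ≤ cliqueGraph G ∧ T.IsTree ∧ ∀ x : V, (T.induce (generatedFamily G {x})).IsTree

/-- The set of clique trees of `G`, as a type. -/
abbrev CliqueTrees (G : SimpleGraph V) : Type u :=
  {T : SimpleGraph (Clique G) // IsCliqueTree G T}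

/-! ### The graphs attached to a clique family -/

variable {G : SimpleGraph V}

/-- The graph on `F` of those edges `KL` of the clique graph for which `K ∩ L` generates a strict
subfamily of `F`. -/
def strictSubfamilyGraph (F : CliqueFamily G) : SimpleGraph F.1 where
  Adj K L := (cliqueGraph G).Adj K.1 L.1 ∧ generatedFamily G (K.1.1 ∩ L.1.1) ⊂ F.1
  symm := ⟨fun _ _ h => ⟨h.1.symm, by rw [Set.inter_comm]; exact h.2⟩⟩
  loopless := ⟨fun _ h => (cliqueGraph G).irrefl h.1⟩

/-- The graph on `F` of those edges `KL` of the clique graph for which `K ∩ L` generates exactly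
`F`. -/
def sameFamilyGraph (F : CliqueFamily G) : SimpleGraph F.1 where
  Adj K L := (cliqueGraph G).Adj K.1 L.1 ∧ generatedFamily G (K.1.1 ∩ L.1.1) = F.1
  symm := ⟨fun _ _ h => ⟨h.1.symm, by rw [Set.inter_comm]; exact h.2⟩⟩
  loopless := ⟨fun _ h => (cliqueGraph G).irrefl h.1⟩

/-- The equivalence relation on `F` whose classes are the connected components of
`strictSubfamilyGraph F`. -/
def familySetoid (F : CliqueFamily G) : Setoid F.1 :=
  (strictSubfamilyGraph F).reachableSetoid

/-- The contracted multigraph of `F`: its vertices are the classes of `familySetoid F`, and its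
edges are labelled by the edges of `sameFamilyGraph F`. -/
def contractionGraph (F : CliqueFamily G) : Graph (Quotient (familySetoid F)) (Sym2 F.1) :=
  contract (Graph.ofSimpleGraph (sameFamilyGraph F)) (familySetoid F)

/-- An edge label of a multigraph attached to `F`, read as an unordered pair of cliques of `G`. -/
def label (F : CliqueFamily G) (e : Sym2 F.1) : Sym2 (Clique G) :=
  e.map Subtype.val

end Cliques

end CliqueTree

namespace CliqueTree

universe u v

/-! ### Cochains modulo two and their potentials -/

section Potential

variable {V : Type u} {H : SimpleGraph V}

/-! An edge KL of the clique graph occurs in exactly one contracted multigraph, that of the family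
generated by K ∩ L, so what must be shown is that a subgraph T of the clique graph is a clique tree
iff all its parts T_F are spanning trees. Acyclicity is treated cohomologically: a graph is a forest
iff every mod 2 cochain on its edges is a coboundary (`isAcyclic_iff_hasPotential`).

If T is a clique tree, it is connected on every clique family F, so each class of F is connected by
strict edges of T. Potentials vanishing on strict edges therefore descend to the contraction, which
makes T_F a tree.

Conversely, induct along strict inclusion of families. Connectedness on F is immediate: T connects
each class, and T_F joins the classes. For acyclicity (`exists_potential_strict`), each vertex x
lying in some but not all cliques of F has a potential g_x on the smaller family of cliques of F
containing x. The sum of g_x and g_y is constant where both apply, and these constants form a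
cocycle on triangles. Chordality makes it a coboundary (`IsChordal.hasPotential`), so the g_x can be
shifted to agree. The result is correct on strict edges, and a potential on T_F repairs the others.
-/

/-- The sum modulo two of the values of `φ` on the edges of a walk. -/
def walkSum (φ : Sym2 V → ZMod 2) {x y : V} (w : H.Walk x y) : ZMod 2 :=
  (w.edges.map φ).sum

/-- `φ` is the coboundary of a function on the vertices of `H`. -/
def HasPotential (H : SimpleGraph V) (φ : Sym2 V → ZMod 2) : Prop :=
  ∃ f : V → ZMod 2, ∀ x y, H.Adj x y → f x + f y = φ s(x, y)

theorem eq_of_reachable {X : Type*} {f : V → X} (hf : ∀ x y, H.Adj x y → f x = f y)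
    {x y : V} (h : H.Reachable x y) : f x = f y := by
  obtain ⟨w⟩ := h
  induction w with
  | nil => rfl
  | cons hadj _ ih => exact (hf _ _ hadj).trans ih

theorem hasPotential_of_walkSum_eq_zero {φ : Sym2 V → ZMod 2}
    (h : ∀ (x : V) (w : H.Walk x x), walkSum φ w = 0) : HasPotential H φ := by
  classical
  have hreach : ∀ x, H.Reachable (H.connectedComponentMk x).out x := fun x =>
    SimpleGraph.ConnectedComponent.exact (Quot.out_eq _)
  let p := fun x => (hreach x).some
  refine ⟨fun x => walkSum φ (p x), fun x y hxy => ?_⟩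
  have hc : (H.connectedComponentMk x).out = (H.connectedComponentMk y).out := by
    rw [SimpleGraph.ConnectedComponent.sound hxy.reachable]
  have := h _ (((p x).concat hxy).append ((p y).reverse.copy rfl hc.symm))
  simp only [walkSum, SimpleGraph.Walk.edges_append, SimpleGraph.Walk.edges_concat,
    SimpleGraph.Walk.edges_copy, SimpleGraph.Walk.edges_reverse, List.map_append, List.map_reverse,
    List.sum_append, List.sum_reverse, List.concat_eq_append, List.map_cons, List.map_nil,
    List.sum_cons, List.sum_nil, add_zero] at this ⊢
  have h2 := CharTwo.add_self_eq_zero (φ s(x, y))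
  linear_combination this - h2

theorem exists_walk_split {x y : V} (w : H.Walk x y) {i j : ℕ} (hij : i ≤ j) (hj : j ≤ w.length) :
    ∃ (p : H.Walk x (w.getVert i)) (q : H.Walk (w.getVert i) (w.getVert j))
      (r : H.Walk (w.getVert j) y), p.length = i ∧ q.length = j - i ∧ r.length = w.length - j ∧
      w.edges = p.edges ++ q.edges ++ r.edges := by
  obtain ⟨k, rfl⟩ := Nat.exists_eq_add_of_le hij
  refine ⟨w.take i, ((w.drop i).take k).copy rfl (SimpleGraph.Walk.drop_getVert ..), w.drop (i + k),
    ?_, ?_, ?_, ?_⟩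
  · simp [SimpleGraph.Walk.take_length]; omega
  · simp [SimpleGraph.Walk.take_length, SimpleGraph.Walk.drop_length]; omega
  · simp [SimpleGraph.Walk.drop_length]
  · have h1 := congrArg SimpleGraph.Walk.edges (w.append_take_drop_eq i)
    have h2 := congrArg SimpleGraph.Walk.edges ((w.drop i).append_take_drop_eq k)
    rw [SimpleGraph.Walk.drop_drop] at h2
    simp only [SimpleGraph.Walk.edges_append, SimpleGraph.Walk.edges_copy] at h1 h2 ⊢
    rw [List.append_assoc, h2, h1]

theorem cycleGraph_adj_iff_of_lt {n : ℕ} {i j : Fin n} (hij : i < j) :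
    (SimpleGraph.cycleGraph n).Adj i j ↔ j.1 = i.1 + 1 ∨ (i.1 = 0 ∧ j.1 + 1 = n) := by
  have hi := i.2
  have hj := j.2
  have hij' : i.1 < j.1 := hij
  have h1 : (j - i).val = j.1 - i.1 := by
    rw [Fin.val_sub, show n - i.1 + j.1 = (j.1 - i.1) + n by omega, Nat.add_mod_right,
      Nat.mod_eq_of_lt (by omega)]
  have h2 : (i - j).val = n - j.1 + i.1 := by
    rw [Fin.val_sub, Nat.mod_eq_of_lt (by omega)]
  rw [SimpleGraph.cycleGraph_adj', h1, h2]
  omega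

/-- A graph with a cochain that has no potential contains a cycle, which is moreover induced and of
length greater than three if the cochain vanishes on triangles. -/
theorem exists_cycle_of_not_hasPotential {φ : Sym2 V → ZMod 2} (h : ¬ HasPotential H φ) :
    ∃ (n : ℕ) (f : Fin n → V), 3 ≤ n ∧ Function.Injective f ∧
      (∀ i j, (SimpleGraph.cycleGraph n).Adj i j → H.Adj (f i) (f j)) ∧
      ((∀ x y z, H.Adj x y → H.Adj y z → H.Adj x z → φ s(x, y) + φ s(y, z) = φ s(x, z)) →
        3 < n ∧ ∀ i j, H.Adj (f i) (f j) → (SimpleGraph.cycleGraph n).Adj i j) := by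
  classical
  have hex : ∃ n, ∃ (x : V) (w : H.Walk x x), w.length = n ∧ walkSum φ w ≠ 0 := by
    by_contra hno
    push Not at hno
    exact h (hasPotential_of_walkSum_eq_zero fun x w => hno _ x w rfl)
  obtain ⟨n, hn, hmin⟩ : ∃ n, (∃ (x : V) (w : H.Walk x x), w.length = n ∧ walkSum φ w ≠ 0) ∧
      ∀ (x : V) (w : H.Walk x x), w.length < n → walkSum φ w = 0 := by
    refine ⟨Nat.find hex, Nat.find_spec hex, fun x w hw => ?_⟩
    by_contra hne
    exact Nat.find_min hex hw ⟨x, w, rfl, hne⟩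
  obtain ⟨x, w, hwn, hw⟩ := hn
  -- A repeated vertex would cut the shortest closed walk of nonzero sum into two shorter closed
  -- walks, both of sum zero.
  have hinj : ∀ i j, i < j → j < n → w.getVert i ≠ w.getVert j := by
    intro i j hij hjn heq
    obtain ⟨p, q, r, hp, hq, hr, he⟩ := exists_walk_split w hij.le (by omega : j ≤ w.length)
    have h1 := hmin _ (q.copy rfl heq.symm) (by simp; omega)
    have h2 := hmin _ (p.append (r.copy heq.symm rfl)) (by simp; omega)
    apply hw
    simp only [walkSum, he, List.map_append, List.sum_append, SimpleGraph.Walk.edges_append,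
      SimpleGraph.Walk.edges_copy] at h1 h2 ⊢
    linear_combination h1 + h2
  -- A chord also gives two shorter closed walks. It is used once in each, so its contribution
  -- cancels mod 2.
  have hchord : ∀ i j, i + 2 ≤ j → j < n → ¬ (i = 0 ∧ j + 1 = n) →
      ¬ H.Adj (w.getVert i) (w.getVert j) := by
    intro i j hij hjn hne hadj
    obtain ⟨p, q, r, hp, hq, hr, he⟩ :=
      exists_walk_split w (by omega : i ≤ j) (by omega : j ≤ w.length)
    have h1 := hmin _ (SimpleGraph.Walk.cons hadj.symm q) (by simp; omega)
    have h2 := hmin _ (p.append (SimpleGraph.Walk.cons hadj r)) (by simp; omega)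
    apply hw
    simp only [walkSum, he, List.map_append, List.sum_append, SimpleGraph.Walk.edges_append,
      SimpleGraph.Walk.edges_cons, List.map_cons, List.sum_cons] at h1 h2 ⊢
    rw [Sym2.eq_swap] at h1
    have h3 := CharTwo.add_self_eq_zero (φ s(w.getVert i, w.getVert j))
    linear_combination h1 + h2 - h3
  have hsucc : ∀ i, i < n → H.Adj (w.getVert i) (w.getVert (i + 1)) := fun i hi =>
    w.adj_getVert_succ (by omega)
  have hlast : w.getVert n = w.getVert 0 := by
    rw [← hwn, SimpleGraph.Walk.getVert_length, SimpleGraph.Walk.getVert_zero]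
  have hn3 : 3 ≤ n := by
    cases w with
    | nil => exact absurd (by simp [walkSum]) hw
    | cons a w => cases w with
      | nil => exact absurd a (H.irrefl)
      | cons b w => cases w with
        | nil =>
          exfalso
          apply hw
          simp only [walkSum, SimpleGraph.Walk.edges_cons, SimpleGraph.Walk.edges_nil, List.map_cons,
            List.map_nil, List.sum_cons, List.sum_nil, add_zero]
          rw [Sym2.eq_swap]
          exact CharTwo.add_self_eq_zero _
        | cons c w => simp at hwn; omega
  have hadjlt : ∀ i j : Fin n, i < j → (SimpleGraph.cycleGraph n).Adj i j →
      H.Adj (w.getVert i) (w.getVert j) := by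
    intro i j hij hadj
    rcases (cycleGraph_adj_iff_of_lt hij).1 hadj with h1 | ⟨h1, h2⟩
    · rw [h1]; exact hsucc _ i.2
    · have h3 := hsucc _ j.2
      rw [h2, hlast] at h3
      rw [h1]
      exact h3.symm
  refine ⟨n, fun i => w.getVert i, hn3, ?_, ?_, fun htri => ⟨?_, ?_⟩⟩
  · intro i j hij
    rcases lt_trichotomy i j with h1 | h1 | h1
    · exact absurd hij (hinj _ _ h1 j.2)
    · exact h1
    · exact absurd hij.symm (hinj _ _ h1 i.2)
  · intro i j hadj
    rcases lt_trichotomy i j with h1 | h1 | h1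
    · exact hadjlt i j h1 hadj
    · exact absurd h1 hadj.ne
    · exact (hadjlt j i h1 hadj.symm).symm
  · refine lt_of_le_of_ne hn3 fun h3 => ?_
    subst h3
    cases w with
    | nil => simp at hwn
    | cons a w => cases w with
      | nil => simp at hwn
      | cons b w => cases w with
        | nil => simp at hwn
        | cons c w => cases w with
          | nil =>
            apply hw
            simp only [walkSum, SimpleGraph.Walk.edges_cons, SimpleGraph.Walk.edges_nil,
              List.map_cons, List.map_nil, List.sum_cons, List.sum_nil, add_zero]
            rw [← add_assoc, htri _ _ _ a b c.symm, Sym2.eq_swap]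
            exact CharTwo.add_self_eq_zero _
          | cons d w => simp at hwn
  · have hlt : ∀ i j : Fin n, i < j → H.Adj (w.getVert i) (w.getVert j) →
        (SimpleGraph.cycleGraph n).Adj i j := by
      intro i j hij hadj
      rw [cycleGraph_adj_iff_of_lt hij]
      by_contra hno
      have hij' : i.1 < j.1 := hij
      exact hchord i j (by omega) j.2 (by omega) hadj
    intro i j hadj
    rcases lt_trichotomy i j with h1 | h1 | h1
    · exact hlt i j h1 hadj
    · exact absurd (h1 ▸ hadj) (H.irrefl)
    · exact (hlt j i h1 hadj.symm).symm

/-- This is the only form in which chordality is used: the first mod 2 cohomology of the clique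
complex vanishes. -/
theorem IsChordal.hasPotential (hH : IsChordal H) {φ : Sym2 V → ZMod 2}
    (htri : ∀ x y z, H.Adj x y → H.Adj y z → H.Adj x z → φ s(x, y) + φ s(y, z) = φ s(x, z)) :
    HasPotential H φ := by
  by_contra h
  obtain ⟨n, f, -, hinj, hadj, hind⟩ := exists_cycle_of_not_hasPotential h
  obtain ⟨hn, hind⟩ := hind htri
  exact (hH n hn).false ⟨⟨f, hinj⟩, fun {i j} => ⟨hind i j, hadj i j⟩⟩

theorem IsChordal.induce (hH : IsChordal H) (s : Set V) : IsChordal (H.induce s) :=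
  fun n hn => ⟨fun f => (hH n hn).false (f.trans (SimpleGraph.Embedding.induce s))⟩

theorem isAcyclic_iff_hasPotential : H.IsAcyclic ↔ ∀ φ, HasPotential H φ := by
  classical
  constructor
  · intro hH φ
    by_contra h
    obtain ⟨n, f, hn, hinj, hadj, -⟩ := exists_cycle_of_not_hasPotential h
    exact SimpleGraph.isAcyclic_iff_free_cycleGraph.1 hH n hn ⟨⟨⟨f, @hadj⟩, hinj⟩⟩
  · intro h
    rw [SimpleGraph.isAcyclic_iff_forall_adj_isBridge]
    intro x y hxy
    rw [SimpleGraph.isBridge_iff]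
    intro hreach
    -- A potential of the indicator of one edge differs at its ends but is constant on components
    -- once that edge is deleted, so the edge is a bridge.
    obtain ⟨f, hf⟩ := h fun e => if e = s(x, y) then 1 else 0
    have h1 : f x = f y := eq_of_reachable (fun a b hab => by
      rw [SimpleGraph.deleteEdges_adj] at hab
      have := hf a b hab.1
      beta_reduce at this
      rw [if_neg (by simpa using hab.2)] at this
      exact CharTwo.add_eq_zero.1 this) hreach
    have h2 := hf x y hxy
    rw [h1, CharTwo.add_self_eq_zero] at h2
    simp at h2

/-- Potentials of an induced subgraph, for functions defined on all vertices. -/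
theorem isAcyclic_induce_iff {s : Set V} : (H.induce s).IsAcyclic ↔ ∀ φ : Sym2 V → ZMod 2,
    ∃ f : V → ZMod 2, ∀ x ∈ s, ∀ y ∈ s, H.Adj x y → f x + f y = φ s(x, y) := by
  classical
  rw [isAcyclic_iff_hasPotential]
  constructor
  · intro h φ
    obtain ⟨f, hf⟩ := h fun e => φ (e.map Subtype.val)
    refine ⟨fun x => if hx : x ∈ s then f ⟨x, hx⟩ else 0, fun x hx y hy hxy => ?_⟩
    simp only [hx, hy, dif_pos]
    exact hf ⟨x, hx⟩ ⟨y, hy⟩ hxy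
  · intro h φ
    obtain ⟨f, hf⟩ := h (Function.extend (Sym2.map Subtype.val) φ 0)
    refine ⟨fun x => f x, fun x y hxy => ?_⟩
    rw [hf x x.2 y y.2 hxy, ← (Sym2.map.injective Subtype.val_injective).extend_apply φ 0 s(x, y),
      Sym2.map_mk]

end Potential

/-! ### Clique families -/

section Families

variable {V : Type u} {G : SimpleGraph V}

theorem exists_clique_superset {C : Set V} (hC : G.IsClique C) : ∃ K : Clique G, C ⊆ K.1 := by
  obtain ⟨K, hCK, hK⟩ := zorn_subset_nonempty {W : Set V | G.IsClique W} (fun c hc hchain _ =>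
    ⟨⋃₀ c, fun x ⟨A, hA, hxA⟩ y ⟨B, hB, hyB⟩ hxy => by
      rcases hchain.total hA hB with h | h
      · exact hc hB (h hxA) hyB hxy
      · exact hc hA hxA (h hyB) hxy, fun s hs => Set.subset_sUnion_of_mem hs⟩) C hC
  exact ⟨⟨K, hK⟩, hCK⟩

theorem CliqueFamily.nonempty (F : CliqueFamily G) : F.1.Nonempty := by
  obtain ⟨F, C, hC, rfl⟩ := F
  exact exists_clique_superset hC

/-- The clique family generated by the intersection of two cliques. -/
def interFamily (K L : Clique G) : CliqueFamily G :=
  ⟨generatedFamily G (K.1 ∩ L.1), _, K.2.prop.subset Set.inter_subset_left, rfl⟩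

theorem left_mem_interFamily (K L : Clique G) : K ∈ (interFamily K L).1 :=
  Set.inter_subset_left (s := K.1) (t := L.1)

theorem right_mem_interFamily (K L : Clique G) : L ∈ (interFamily K L).1 :=
  Set.inter_subset_right (s := K.1) (t := L.1)

theorem interFamily_subset (F : CliqueFamily G) {K L : Clique G} (hK : K ∈ F.1) (hL : L ∈ F.1) :
    (interFamily K L).1 ⊆ F.1 := by
  obtain ⟨F, C, hC, rfl⟩ := F
  exact fun M hM => (Set.subset_inter hK hL).trans hM

/-- The common clique K makes C ∪ D complete, so the intersection is generated by C ∪ D. -/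
theorem exists_cliqueFamily_inter (F : CliqueFamily G) {D : Set V}
    (hD : ∃ K ∈ F.1, D ⊆ K.1) : ∃ F' : CliqueFamily G, F'.1 = F.1 ∩ generatedFamily G D := by
  obtain ⟨F, C, hC, rfl⟩ := F
  obtain ⟨K, hK, hDK⟩ := hD
  exact ⟨⟨_, C ∪ D, K.2.prop.subset (Set.union_subset hK hDK), rfl⟩, by
    ext; simp [generatedFamily, Set.union_subset_iff]⟩

/-- A complete set all of whose vertices lie in cliques of a clique family lies in such a clique. -/
theorem exists_mem_family_superset (F : CliqueFamily G) {D : Set V} (hD : G.IsClique D)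
    (h : ∀ x ∈ D, ∃ K ∈ F.1, x ∈ K.1) : ∃ K ∈ F.1, D ⊆ K.1 := by
  obtain ⟨F, C, hC, rfl⟩ := F
  have hCD : G.IsClique (C ∪ D) := by
    have hmix : ∀ x ∈ C, ∀ y ∈ D, x ≠ y → G.Adj x y := fun x hx y hy hxy => by
      obtain ⟨K, hK, hyK⟩ := h y hy
      exact K.2.prop (hK hx) hyK hxy
    rintro x (hx | hx) y (hy | hy) hxy
    · exact hC hx hy hxy
    · exact hmix x hx y hy hxy
    · exact (hmix y hy x hx hxy.symm).symm
    · exact hD hx hy hxy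
  obtain ⟨K, hK⟩ := exists_clique_superset hCD
  exact ⟨K, Set.subset_union_left.trans hK, Set.subset_union_right.trans hK⟩

/-- The clique family of all cliques. -/
def univFamily (G : SimpleGraph V) : CliqueFamily G :=
  ⟨Set.univ, ∅, by simp, by simp [generatedFamily]⟩

/-- The clique family of all cliques containing a given vertex. -/
def vertexFamily (G : SimpleGraph V) (x : V) : CliqueFamily G :=
  ⟨generatedFamily G {x}, {x}, by simp, rfl⟩

theorem finite_generatedFamily [G.LocallyFinite] {C : Set V} (hC : C.Nonempty) :
    (generatedFamily G C).Finite := by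
  obtain ⟨x, hx⟩ := hC
  refine Set.Finite.of_finite_image (f := Subtype.val) ?_ Subtype.val_injective.injOn
  refine ((Set.toFinite (insert x (G.neighborSet x))).finite_subsets).subset ?_
  rintro _ ⟨K, hK, rfl⟩ y hy
  by_cases hxy : x = y
  · exact Or.inl hxy.symm
  · exact Or.inr (K.2.prop (hK hx) hy hxy)

/-- Induction on clique families along strict inclusion. -/
theorem CliqueFamily.induction [G.LocallyFinite] {P : CliqueFamily G → Prop}
    (step : ∀ F : CliqueFamily G, (∀ F' : CliqueFamily G, F'.1 ⊂ F.1 → P F') → P F)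
    (F : CliqueFamily G) : P F := by
  have hfin : ∀ (n : ℕ) (F : CliqueFamily G), F.1.Finite → F.1.ncard = n → P F := by
    intro n
    induction n using Nat.strong_induction_on with
    | _ n ih =>
      rintro F hF rfl
      exact step F fun F' hF' =>
        ih _ (Set.ncard_lt_ncard hF' hF) F' (hF.subset hF'.subset) rfl
  -- F may be infinite, but a proper subfamily has a nonempty generating set and is thus finite.
  refine step F fun F' hF' => ?_
  obtain ⟨F', C, hC, rfl⟩ := F'
  rcases C.eq_empty_or_nonempty with rfl | hne
  · exact absurd (fun K _ => Set.empty_subset K.1 : F.1 ⊆ generatedFamily G ∅) hF'.not_subset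
  · exact hfin _ _ (finite_generatedFamily hne) rfl

end Families

/-! ### The edges of the contracted multigraphs -/

section Split

variable {V : Type u} {G : SimpleGraph V}

theorem contractionGraph_isLink {F : CliqueFamily G} {e : Sym2 F.1}
    {x y : Quotient (familySetoid F)} :
    (contractionGraph F).IsLink e x y ↔ ∃ K L : F.1, (sameFamilyGraph F).Adj K L ∧ e = s(K, L) ∧
      x = Quotient.mk (familySetoid F) K ∧ y = Quotient.mk (familySetoid F) L := by
  constructor
  · rintro ⟨K, L, ⟨rfl, h⟩, rfl, rfl⟩
    exact ⟨K, L, h, rfl, rfl, rfl⟩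
  · rintro ⟨K, L, h, rfl, rfl, rfl⟩
    exact ⟨K, L, ⟨rfl, h⟩, rfl, rfl⟩

theorem vertexSet_contractionGraph (F : CliqueFamily G) :
    (contractionGraph F).vertexSet = Set.univ := by
  refine Set.eq_univ_of_forall fun x => ?_
  induction x using Quotient.inductionOn with
  | _ K => exact ⟨K, trivial, rfl⟩

theorem label_injective (F : CliqueFamily G) : Function.Injective (label F) :=
  Sym2.map.injective Subtype.val_injective

theorem mem_label_image_iff {F : CliqueFamily G} {K L : Clique G} :
    s(K, L) ∈ label F '' (contractionGraph F).edgeSet ↔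
      (cliqueGraph G).Adj K L ∧ interFamily K L = F := by
  constructor
  · rintro ⟨e, he, heq⟩
    induction e with
    | _ A B =>
      have hAB : (sameFamilyGraph F).Adj A B := he
      rcases Sym2.eq_iff.1 heq with ⟨h1, h2⟩ | ⟨h1, h2⟩
      · subst h1 h2
        exact ⟨hAB.1, Subtype.ext hAB.2⟩
      · subst h1 h2
        exact ⟨hAB.1.symm, Subtype.ext hAB.symm.2⟩
  · rintro ⟨h, rfl⟩
    exact ⟨s(⟨K, left_mem_interFamily K L⟩, ⟨L, right_mem_interFamily K L⟩), ⟨h, rfl⟩, rfl⟩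

theorem mem_edgeSet_cliqueGraph_iff (e : Sym2 (Clique G)) :
    e ∈ (cliqueGraph G).edgeSet ↔
      ∃! F : CliqueFamily G, e ∈ label F '' (contractionGraph F).edgeSet := by
  induction e with
  | _ K L =>
    simp only [mem_label_image_iff]
    exact ⟨fun h => ⟨_, ⟨h, rfl⟩, fun F hF => hF.2.symm⟩, fun ⟨F, hF, _⟩ => hF.1⟩

/-- The submultigraph of the contracted multigraph of `F` formed by the edges labelled by edges
of `T`. -/
def split (T : SimpleGraph (Clique G)) (F : CliqueFamily G) :
    Graph (Quotient (familySetoid F)) (Sym2 F.1) :=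
  (contractionGraph F).restrict {e | label F e ∈ T.edgeSet}

variable {T : SimpleGraph (Clique G)} {F : CliqueFamily G}

theorem split_isSpanningSubgraph (T : SimpleGraph (Clique G)) (F : CliqueFamily G) :
    (split T F).IsSpanningSubgraph (contractionGraph F) :=
  ⟨Graph.restrict_le, rfl⟩

theorem edgeSet_split (T : SimpleGraph (Clique G)) (F : CliqueFamily G) :
    (split T F).edgeSet = {e | e ∈ (contractionGraph F).edgeSet ∧ label F e ∈ T.edgeSet} :=
  rfl

theorem split_isLink {e : Sym2 F.1} {x y : Quotient (familySetoid F)} :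
    (split T F).IsLink e x y ↔ ∃ K L : F.1, (sameFamilyGraph F).Adj K L ∧ T.Adj K.1 L.1 ∧
      e = s(K, L) ∧ x = Quotient.mk (familySetoid F) K ∧ y = Quotient.mk (familySetoid F) L := by
  have : (split T F).IsLink e x y ↔ label F e ∈ T.edgeSet ∧ (contractionGraph F).IsLink e x y :=
    Iff.rfl
  rw [this, contractionGraph_isLink]
  constructor
  · rintro ⟨h, K, L, h1, rfl, h2, h3⟩
    exact ⟨K, L, h1, h, rfl, h2, h3⟩
  · rintro ⟨K, L, h1, h, rfl, h2, h3⟩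
    exact ⟨h, K, L, h1, rfl, h2, h3⟩

theorem adj_cases (hT : T ≤ cliqueGraph G) {K L : F.1} (h : T.Adj K.1 L.1) :
    (strictSubfamilyGraph F).Adj K L ∨ (sameFamilyGraph F).Adj K L := by
  rcases (interFamily_subset F K.2 L.2).eq_or_ssubset with h1 | h1
  · exact Or.inr ⟨hT h, h1⟩
  · exact Or.inl ⟨hT h, h1⟩

/-- If all smaller families induce connected subgraphs of `T`, then each class of a clique family is
connected through strict edges of `T`. -/
theorem eq_of_familySetoid {X : Type*} (hT : T ≤ cliqueGraph G)
    (hconn : ∀ F' : CliqueFamily G, F'.1 ⊂ F.1 → (T.induce F'.1).Preconnected) {f : F.1 → X}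
    (hf : ∀ K L : F.1, (strictSubfamilyGraph F).Adj K L → T.Adj K.1 L.1 → f K = f L)
    {K L : F.1} (h : Quotient.mk (familySetoid F) K = Quotient.mk (familySetoid F) L) :
    f K = f L := by
  refine eq_of_reachable (fun A B hAB => ?_) (Quotient.exact h)
  -- T joins A to B inside the family of A ∩ B, and every edge there is strict in F.
  have hss : (interFamily A.1 B.1).1 ⊂ F.1 := hAB.2
  have := hconn _ hss ⟨A.1, left_mem_interFamily A.1 B.1⟩ ⟨B.1, right_mem_interFamily A.1 B.1⟩
  exact eq_of_reachable (f := fun M : (interFamily A.1 B.1).1 => f ⟨M.1, hss.subset M.2⟩)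
    (fun M N hMN => hf _ _ ⟨hT hMN,
      (interFamily_subset _ M.2 N.2).trans_ssubset hss⟩ hMN) this

end Split

/-! ### Splitting a clique tree -/

section CliqueTreeToFamily

variable {V : Type u} {G : SimpleGraph V} {T : SimpleGraph (Clique G)}

/-- For each x in C, uniqueness of paths identifies the T-path from K to L with the path in the
subtree of x, so every clique on it contains x. -/
theorem IsCliqueTree.preconnected_induce (hT : IsCliqueTree G T) (F : CliqueFamily G) :
    (T.induce F.1).Preconnected := by
  classical
  obtain ⟨F, C, hC, rfl⟩ := F
  intro K L
  obtain ⟨p, hp, hpu⟩ := hT.2.1.existsUnique_path K.1 L.1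
  suffices h : ∀ M ∈ p.support, M ∈ generatedFamily G C from ⟨p.induce _ h⟩
  intro M hM x hx
  have hK : K.1 ∈ generatedFamily G {x} := Set.singleton_subset_iff.2 (K.2 hx)
  have hL : L.1 ∈ generatedFamily G {x} := Set.singleton_subset_iff.2 (L.2 hx)
  obtain ⟨q, hq, -⟩ := (hT.2.2 x).existsUnique_path ⟨K.1, hK⟩ ⟨L.1, hL⟩
  have hqp := hpu (q.map (SimpleGraph.Embedding.induce _).toHom)
    (hq.map Subtype.val_injective)
  rw [← hqp] at hM
  obtain ⟨N, -, rfl⟩ :=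
    List.mem_map.1 ((congrArg (M ∈ ·) (SimpleGraph.Walk.support_map _ q)).mp hM)
  exact N.2 rfl

theorem IsCliqueTree.isSpanningTree_split (hT : IsCliqueTree G T) (F : CliqueFamily G) :
    IsSpanningTree (split T F) (contractionGraph F) := by
  classical
  have hpot : ∀ φ : Sym2 F.1 → ZMod 2, (∀ K L, (strictSubfamilyGraph F).Adj K L →
      φ s(K, L) = 0) → ∃ f : Quotient (familySetoid F) → ZMod 2,
        ∀ e x y, (split T F).IsLink e x y → f x + f y = φ e := by
    intro φ hφ
    obtain ⟨f, hf⟩ := isAcyclic_iff_hasPotential.1 (hT.2.1.isAcyclic.induce F.1) φ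
    refine ⟨Quotient.lift f fun K L hKL => ?_, ?_⟩
    · refine eq_of_familySetoid hT.1 (fun F' _ => hT.preconnected_induce F') (fun K L hs hKL => ?_)
        (Quotient.sound hKL)
      have := hf K L hKL
      rw [hφ K L hs] at this
      exact CharTwo.add_eq_zero.1 this
    · intro e x y he
      obtain ⟨K, L, -, hKL, rfl, rfl, rfl⟩ := split_isLink.1 he
      exact hf K L hKL
  -- A cut separating the ends of e and crossed by no other edge: it excludes loops, parallel edges
  -- and cycles alike.
  have hsame : ∀ e x y, (split T F).IsLink e x y → ∃ f : Quotient (familySetoid F) → ZMod 2,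
      f x + f y = 1 ∧ ∀ e' x' y', (split T F).IsLink e' x' y' → e' ≠ e → f x' + f y' = 0 := by
    intro e x y he
    obtain ⟨f, hf⟩ := hpot (fun e' => if e' = e then 1 else 0) (fun K L hKL => by
      obtain ⟨A, B, hAB, -, rfl, -, -⟩ := split_isLink.1 he
      refine if_neg fun heq => ?_
      have hKL' : (sameFamilyGraph F).Adj K L := by
        change s(K, L) ∈ (sameFamilyGraph F).edgeSet
        rw [heq]
        exact hAB
      exact hKL.2.ne hKL'.2)
    refine ⟨f, by simpa using hf e x y he, fun e' x' y' he' hne => ?_⟩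
    simpa [hne] using hf e' x' y' he'
  have hloop : (split T F).Loopless := ⟨fun e x he => by
    obtain ⟨f, hf, -⟩ := hsame e x x he
    simp [CharTwo.add_self_eq_zero] at hf⟩
  refine ⟨split_isSpanningSubgraph T F, ⟨fun e e' x y he he' => ?_⟩, ⟨?_, ?_⟩⟩
  · by_contra hne
    obtain ⟨f, hf, hf'⟩ := hsame e x y he
    rw [hf' e' x y he' (Ne.symm hne)] at hf
    exact zero_ne_one hf
  · have hmem : ∀ x, x ∈ (split T F).vertexSet := fun x => by
      rw [(split_isSpanningSubgraph T F).vertexSet_eq, vertexSet_contractionGraph]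
      trivial
    have : Nonempty (split T F).vertexSet := by
      obtain ⟨K, hK⟩ := F.nonempty
      exact ⟨⟨Quotient.mk _ ⟨K, hK⟩, hmem _⟩⟩
    refine ⟨?_⟩
    rintro ⟨x, hx⟩ ⟨y, hy⟩
    induction x using Quotient.inductionOn with
    | _ K => induction y using Quotient.inductionOn with
      | _ L =>
        refine SimpleGraph.ConnectedComponent.exact ?_
        refine eq_of_reachable (f := fun M : F.1 => (split T F).toSimpleGraph.connectedComponentMk
          ⟨Quotient.mk _ M, hmem _⟩) (fun M N hMN => ?_) (hT.preconnected_induce F K L)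
        rcases adj_cases hT.1 hMN with h | h
        · have : Quotient.mk (familySetoid F) M = Quotient.mk (familySetoid F) N :=
            Quotient.sound h.reachable
          simp only [this]
        · refine SimpleGraph.ConnectedComponent.sound (SimpleGraph.Adj.reachable ?_)
          rw [Graph.toSimpleGraph_adj_iff]
          exact ⟨_, split_isLink.2 ⟨M, N, h, hMN, rfl, rfl, rfl⟩⟩
  · rw [SimpleGraph.isAcyclic_iff_forall_adj_isBridge]
    rintro x y ⟨hxy, e, he⟩
    rw [SimpleGraph.isBridge_iff]
    intro hreach
    obtain ⟨f, hf, hf'⟩ := hsame e x y he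
    have : f x = f y := eq_of_reachable (f := fun z : (split T F).vertexSet => f z)
      (fun a b hab => by
        rw [SimpleGraph.deleteEdges_adj] at hab
        obtain ⟨⟨-, e', he'⟩, hne⟩ := hab
        refine CharTwo.add_eq_zero.1 (hf' e' a b he' ?_)
        rintro rfl
        apply hne
        rw [Set.mem_singleton_iff, Sym2.eq_iff, Subtype.ext_iff, Subtype.ext_iff, Subtype.ext_iff,
          Subtype.ext_iff]
        exact he'.eq_and_eq_or_eq_and_eq he) hreach
    rw [this, CharTwo.add_self_eq_zero] at hf
    exact zero_ne_one hf

end CliqueTreeToFamily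

/-! ### Assembling a clique tree -/

section FamilyToCliqueTree

variable {V : Type u} {G : SimpleGraph V} {T : SimpleGraph (Clique G)}

/-- By induction T connects every class inside F, so components of T on F are a function of the
class; the edges of the spanning tree then identify them all. -/
theorem preconnected_induce_of_split [G.LocallyFinite] (hT : T ≤ cliqueGraph G)
    (hS : ∀ F, IsSpanningTree (split T F) (contractionGraph F)) (F : CliqueFamily G) :
    (T.induce F.1).Preconnected := by
  induction F using CliqueFamily.induction with
  | step F ih =>
    have hmem : ∀ x, x ∈ (split T F).vertexSet := fun x => by
      rw [(split_isSpanningSubgraph T F).vertexSet_eq, vertexSet_contractionGraph]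
      trivial
    let g : Quotient (familySetoid F) → (T.induce F.1).ConnectedComponent :=
      Quotient.lift (fun K => (T.induce F.1).connectedComponentMk K) fun K L hKL =>
        eq_of_familySetoid (f := (T.induce F.1).connectedComponentMk) hT ih (fun A B _ hAB =>
          SimpleGraph.ConnectedComponent.sound (SimpleGraph.Adj.reachable hAB)) (Quotient.sound hKL)
    intro K L
    refine SimpleGraph.ConnectedComponent.exact ?_
    refine eq_of_reachable (f := fun x : (split T F).vertexSet => g x) (fun x y hxy => ?_)
      ((hS F).2.2.connected.preconnected ⟨Quotient.mk _ K, hmem _⟩ ⟨Quotient.mk _ L, hmem _⟩)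
    obtain ⟨-, e, he⟩ := hxy
    obtain ⟨A, B, -, hAB, -, hx, hy⟩ := split_isLink.1 he
    simp only [hx, hy]
    exact SimpleGraph.ConnectedComponent.sound (SimpleGraph.Adj.reachable hAB)

theorem IsSpanningTree.exists_potential {α : Type u} {β : Type v} {H M : Graph α β}
    (hH : IsSpanningTree H M) (φ : β → ZMod 2) :
    ∃ f : α → ZMod 2, ∀ e x y, H.IsLink e x y → f x + f y = φ e := by
  classical
  have := hH.2.1
  -- Without parallel edges, a cochain on labels is a cochain on vertex pairs; pairs not linked get
  -- the value 0.
  have hψ : ∀ p : Sym2 H.vertexSet, ∃ t, ∀ e x y, H.IsLink e x.1 y.1 → p = s(x, y) → t = φ e := by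
    intro p
    by_cases h : ∃ e x y, H.IsLink e x.1 y.1 ∧ p = s(x, y)
    · obtain ⟨e, x, y, he, rfl⟩ := h
      refine ⟨φ e, fun e' x' y' he' heq => ?_⟩
      rcases Sym2.eq_iff.1 heq with ⟨rfl, rfl⟩ | ⟨rfl, rfl⟩
      · rw [he.eq he']
      · rw [he.symm.eq he']
    · exact ⟨0, fun e x y he hp => absurd ⟨e, x, y, he, hp⟩ h⟩
  choose ψ hψ using hψ
  obtain ⟨f, hf⟩ := isAcyclic_iff_hasPotential.1 hH.2.2.isAcyclic ψ
  refine ⟨fun x => if hx : x ∈ H.vertexSet then f ⟨x, hx⟩ else 0, fun e x y he => ?_⟩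
  simp only [he.left_mem, he.right_mem, dif_pos]
  rw [hf ⟨x, he.left_mem⟩ ⟨y, he.right_mem⟩ ⟨fun h => he.ne (congrArg Subtype.val h), e, he⟩]
  exact hψ _ e ⟨x, he.left_mem⟩ ⟨y, he.right_mem⟩ he rfl

/-- In a chordal graph, potentials on the subtrees of the smaller families glue to a function that
is a potential along strict edges. -/
theorem exists_potential_strict [G.LocallyFinite] (hG : IsChordal G)
    (hconn : ∀ F : CliqueFamily G, (T.induce F.1).Preconnected) (F : CliqueFamily G)
    (ih : ∀ F' : CliqueFamily G, F'.1 ⊂ F.1 → (T.induce F'.1).IsAcyclic)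
    (φ : Sym2 (Clique G) → ZMod 2) : ∃ f : Clique G → ZMod 2, ∀ K L : F.1,
      (strictSubfamilyGraph F).Adj K L → T.Adj K.1 L.1 → f K + f L = φ s(K.1, L.1) := by
  classical
  -- The vertices that cut out a nonempty proper subfamily of F, to which `ih` applies.
  let W : Set V := {x | (∃ K ∈ F.1, x ∈ K.1) ∧ ∃ K ∈ F.1, x ∉ K.1}
  have hg : ∀ x : W, ∃ g : Clique G → ZMod 2, ∀ K ∈ F.1, x.1 ∈ K.1 → ∀ L ∈ F.1, x.1 ∈ L.1 →
      T.Adj K L → g K + g L = φ s(K, L) := by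
    rintro ⟨x, ⟨K, hK, hxK⟩, M, hM, hxM⟩
    obtain ⟨F', hF'⟩ := exists_cliqueFamily_inter F (D := {x}) ⟨K, hK, by simpa using hxK⟩
    have hss : F'.1 ⊂ F.1 := by
      rw [hF']
      exact ⟨Set.inter_subset_left, fun h => hxM ((h hM).2 rfl)⟩
    obtain ⟨g, hg⟩ := isAcyclic_induce_iff.1 (ih F' hss) φ
    rw [hF'] at hg
    exact ⟨g, fun A hA hxA B hB hxB hAB => hg A ⟨hA, by simpa [generatedFamily] using hxA⟩
      B ⟨hB, by simpa [generatedFamily] using hxB⟩ hAB⟩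
  choose g hg using hg
  -- Along an edge of T both potentials change by the same φ, so their sum is constant on the
  -- connected family of cliques of F containing x and y. Pairs in no common clique of F get 0.
  have hd : ∀ e : Sym2 W, ∃ t, ∀ x y : W, e = s(x, y) → ∀ K ∈ F.1, x.1 ∈ K.1 → y.1 ∈ K.1 →
      g x K + g y K = t := by
    intro e
    induction e with
    | _ a b =>
      by_cases h : ∃ K ∈ F.1, {a.1, b.1} ⊆ K.1
      · obtain ⟨F', hF'⟩ := exists_cliqueFamily_inter F h
        obtain ⟨K₀, hK₀, hab⟩ := h
        have hmem : ∀ {K}, K ∈ F'.1 ↔ K ∈ F.1 ∧ a.1 ∈ K.1 ∧ b.1 ∈ K.1 := by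
          intro K
          rw [hF']
          simp [generatedFamily, Set.insert_subset_iff]
        have key : ∀ K ∈ F.1, a.1 ∈ K.1 → b.1 ∈ K.1 → g a K + g b K = g a K₀ + g b K₀ := by
          intro K hK haK hbK
          refine eq_of_reachable (f := fun M : F'.1 => g a M + g b M) (fun M N hMN => ?_)
            (hconn F' ⟨K, hmem.2 ⟨hK, haK, hbK⟩⟩
              ⟨K₀, hmem.2 ⟨hK₀, hab (by simp), hab (by simp)⟩⟩)
          obtain ⟨hM, haM, hbM⟩ := hmem.1 M.2
          obtain ⟨hN, haN, hbN⟩ := hmem.1 N.2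
          have h1 := hg a M hM haM N hN haN hMN
          have h2 := hg b M hM hbM N hN hbN hMN
          refine CharTwo.add_eq_zero.1 ?_
          have h3 := CharTwo.add_self_eq_zero (φ s(M.1, N.1))
          linear_combination h1 + h2 + h3
        refine ⟨g a K₀ + g b K₀, fun x y hxy K hK hx hy => ?_⟩
        rcases Sym2.eq_iff.1 hxy with ⟨rfl, rfl⟩ | ⟨rfl, rfl⟩
        · exact key K hK hx hy
        · rw [add_comm]
          exact key K hK hy hx
      · refine ⟨0, fun x y hxy K hK hx hy => absurd ⟨K, hK, ?_⟩ h⟩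
        rcases Sym2.eq_iff.1 hxy with ⟨rfl, rfl⟩ | ⟨rfl, rfl⟩
        · simp [Set.insert_subset_iff, hx, hy]
        · simp [Set.insert_subset_iff, hx, hy]
  choose d hd using hd
  -- A triangle in W lies in a single clique K of F; evaluating all three constants at K gives the
  -- cocycle condition.
  obtain ⟨h, hh⟩ := (hG.induce W).hasPotential (φ := d) fun x y z hxy hyz hxz => by
    have hclique : G.IsClique {x.1, y.1, z.1} := by
      have h1 : G.Adj x.1 y.1 := hxy
      have h2 : G.Adj y.1 z.1 := hyz
      have h3 : G.Adj x.1 z.1 := hxz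
      simp [SimpleGraph.isClique_insert, h1, h2, h3]
    obtain ⟨K, hK, hDK⟩ := exists_mem_family_superset F hclique (by
      rintro a (rfl | rfl | rfl)
      exacts [x.2.1, y.2.1, z.2.1])
    have hx : x.1 ∈ K.1 := hDK (by simp)
    have hy : y.1 ∈ K.1 := hDK (by simp)
    have hz : z.1 ∈ K.1 := hDK (by simp)
    rw [← hd _ x y rfl K hK hx hy, ← hd _ y z rfl K hK hy hz, ← hd _ x z rfl K hK hx hz]
    have := CharTwo.add_self_eq_zero (g y K)
    linear_combination this
  have hf : ∀ K : Clique G, ∃ t, K ∈ F.1 → ∀ x : W, x.1 ∈ K.1 → g x K + h x = t := by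
    intro K
    by_cases hK : K ∈ F.1 ∧ ∃ x : W, x.1 ∈ K.1
    · obtain ⟨hK, y, hy⟩ := hK
      refine ⟨g y K + h y, fun _ x hx => ?_⟩
      by_cases hxy : x = y
      · rw [hxy]
      · have h1 := hh x y (K.2.prop hx hy fun h => hxy (Subtype.ext h))
        rw [← hd _ x y rfl K hK hx hy] at h1
        refine CharTwo.add_eq_zero.1 ?_
        have h2 := CharTwo.add_self_eq_zero (g x K + g y K)
        linear_combination h1 + h2
    · exact ⟨0, fun h1 x hx => absurd ⟨h1, x, hx⟩ hK⟩
  choose f hf using hf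
  refine ⟨f, fun K L hKL hadj => ?_⟩
  -- Strictness provides a clique M of F missing some x in K ∩ L, so x is in W and g_x governs the
  -- edge KL.
  obtain ⟨M, hM, hKLM⟩ := Set.exists_of_ssubset hKL.2
  obtain ⟨x, ⟨hxK, hxL⟩, hxM⟩ := Set.not_subset.1 hKLM
  let x' : W := ⟨x, ⟨K.1, K.2, hxK⟩, M, hM, hxM⟩
  rw [← hf K.1 K.2 x' hxK, ← hf L.1 L.2 x' hxL, ← hg x' K.1 K.2 hxK L.1 L.2 hxL hadj]
  have := CharTwo.add_self_eq_zero (h x')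
  linear_combination this

theorem isAcyclic_induce_of_split [G.LocallyFinite] (hG : IsChordal G) (hT : T ≤ cliqueGraph G)
    (hS : ∀ F, IsSpanningTree (split T F) (contractionGraph F)) (F : CliqueFamily G) :
    (T.induce F.1).IsAcyclic := by
  classical
  induction F using CliqueFamily.induction with
  | step F ih =>
    rw [isAcyclic_induce_iff]
    intro φ
    obtain ⟨f, hf⟩ := exists_potential_strict hG (preconnected_induce_of_split hT hS) F ih φ
    let c : Sym2 F.1 → ZMod 2 := Sym2.lift ⟨fun K L => f K + f L, fun K L => add_comm _ _⟩
    -- The error of f on the remaining edges. Its potential h is constant on classes, so adding it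
    -- leaves strict edges correct.
    obtain ⟨h, hh⟩ := (hS F).exists_potential fun e => φ (label F e) + c e
    refine ⟨fun K => f K + if hK : K ∈ F.1 then h (Quotient.mk _ ⟨K, hK⟩) else 0, ?_⟩
    intro K hK L hL hKL
    simp only [hK, hL, dif_pos]
    rcases adj_cases (K := ⟨K, hK⟩) (L := ⟨L, hL⟩) hT hKL with h1 | h1
    · have h2 : Quotient.mk (familySetoid F) ⟨K, hK⟩ = Quotient.mk (familySetoid F) ⟨L, hL⟩ :=
        Quotient.sound h1.reachable
      rw [h2, ← hf _ _ h1 hKL]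
      have := CharTwo.add_self_eq_zero (h (Quotient.mk (familySetoid F) ⟨L, hL⟩))
      linear_combination this
    · have h2 : _ = φ s(K, L) + (f K + f L) :=
        hh _ _ _ (split_isLink.2 ⟨⟨K, hK⟩, ⟨L, hL⟩, h1, hKL, rfl, rfl, rfl⟩)
      have := CharTwo.add_self_eq_zero (f K + f L)
      linear_combination h2 + this

theorem isCliqueTree_of_split [G.LocallyFinite] (hG : IsChordal G) (hT : T ≤ cliqueGraph G)
    (hS : ∀ F, IsSpanningTree (split T F) (contractionGraph F)) : IsCliqueTree G T := by
  have htree : ∀ F : CliqueFamily G, (T.induce F.1).IsTree := fun F =>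
    have : Nonempty F.1 := F.nonempty.to_subtype
    ⟨⟨preconnected_induce_of_split hT hS F⟩, isAcyclic_induce_of_split hG hT hS F⟩
  exact ⟨hT, (SimpleGraph.induceUnivIso T).isTree_iff.1 (htree (univFamily G)),
    fun x => htree (vertexFamily G x)⟩

end FamilyToCliqueTree

/-! ### The bijection -/

section Bijection

variable {V : Type u} {G : SimpleGraph V}

/-- The graph on the cliques whose edges are the labels of a family of spanning trees. -/
def union (S : ∀ F : CliqueFamily G, SpanningTree (contractionGraph F)) :
    SimpleGraph (Clique G) :=
  SimpleGraph.fromEdgeSet (⋃ F : CliqueFamily G, label F '' (S F).1.edgeSet)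

variable (S : ∀ F : CliqueFamily G, SpanningTree (contractionGraph F))

theorem label_image_subset (F : CliqueFamily G) :
    label F '' (S F).1.edgeSet ⊆ label F '' (contractionGraph F).edgeSet :=
  Set.image_mono (S F).2.1.le.edgeSet_mono

theorem iUnion_label_subset :
    (⋃ F : CliqueFamily G, label F '' (S F).1.edgeSet) ⊆ (cliqueGraph G).edgeSet := by
  refine Set.iUnion_subset fun F e he => ?_
  induction e with
  | _ K L => exact (mem_label_image_iff.1 (label_image_subset S F he)).1

theorem edgeSet_union :
    (union S).edgeSet = ⋃ F : CliqueFamily G, label F '' (S F).1.edgeSet := by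
  rw [union, SimpleGraph.edgeSet_fromEdgeSet, sdiff_eq_left]
  refine Set.disjoint_left.2 fun e he hdiag => ?_
  exact (cliqueGraph G).not_isDiag_of_mem_edgeSet (iUnion_label_subset S he) hdiag

theorem union_le : union S ≤ cliqueGraph G := by
  rw [← SimpleGraph.edgeSet_subset_edgeSet, edgeSet_union]
  exact iUnion_label_subset S

theorem split_union (F : CliqueFamily G) : split (union S) F = (S F).1 := by
  have hle := (S F).2.1
  refine Graph.Compatible.ext hle.vertexSet_eq.symm ?_
    (Graph.Compatible.of_le_le (split_isSpanningSubgraph _ F).le hle.le)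
  ext e
  rw [edgeSet_split, edgeSet_union]
  constructor
  · rintro ⟨he, hlab⟩
    obtain ⟨F', e', he', heq⟩ := Set.mem_iUnion.1 hlab
    have hF := (mem_edgeSet_cliqueGraph_iff _).1 (iUnion_label_subset S hlab)
    -- Uniqueness of the family of a label keeps the edges of other families out of the part of F.
    obtain rfl : F' = F :=
      hF.unique ⟨e', (S F').2.1.le.edgeSet_mono he', heq⟩ ⟨e, he, rfl⟩
    rwa [← label_injective F' heq]
  · exact fun he => ⟨hle.le.edgeSet_mono he, Set.mem_iUnion.2 ⟨F, e, he, rfl⟩⟩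

theorem union_split {T : SimpleGraph (Clique G)} (hT : T ≤ cliqueGraph G)
    (hS : ∀ F, (S F).1 = split T F) : union S = T := by
  rw [← SimpleGraph.edgeSet_inj, edgeSet_union]
  ext e
  simp only [hS, Set.mem_iUnion]
  constructor
  · rintro ⟨F, e', he', rfl⟩
    exact he'.2
  · intro he
    obtain ⟨F, ⟨e', he', heq⟩, -⟩ :=
      (mem_edgeSet_cliqueGraph_iff e).1 (SimpleGraph.edgeSet_mono hT he)
    exact ⟨F, e', ⟨he', by rwa [Set.mem_ofPred_eq, heq]⟩, heq⟩

/-- Splitting the edges of clique trees, as a bijection. -/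
def splitEquiv [G.LocallyFinite] (hG : IsChordal G) :
    CliqueTrees G ≃ (∀ F : CliqueFamily G, SpanningTree (contractionGraph F)) where
  toFun T F := ⟨split T.1 F, T.2.isSpanningTree_split F⟩
  invFun S := ⟨union S, isCliqueTree_of_split hG (union_le S) fun F => by
    rw [split_union]
    exact (S F).2⟩
  left_inv T := Subtype.ext (union_split _ T.2.1 fun _ => rfl)
  right_inv S := funext fun F => Subtype.ext (split_union S F)

end Bijection

end CliqueTree

theorem mainTheorem2 {V : Type*} (G : SimpleGraph V) [G.LocallyFinite]
    (hconn : G.Connected) (hchordal : CliqueTree.IsChordal G) :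
    -- the edge labels of the contracted multigraphs partition the edges of the clique graph
    (∀ e : Sym2 (CliqueTree.Clique G),
      e ∈ (CliqueTree.cliqueGraph G).edgeSet ↔
        ∃! F : CliqueTree.CliqueFamily G,
          e ∈ CliqueTree.label F '' (CliqueTree.contractionGraph F).edgeSet) ∧
    -- splitting the edges of a clique tree along this partition is a bijection
    ∃ Φ : CliqueTree.CliqueTrees G ≃
        (∀ F : CliqueTree.CliqueFamily G,
          CliqueTree.SpanningTree (CliqueTree.contractionGraph F)),
      (∀ (T : CliqueTree.CliqueTrees G) (F : CliqueTree.CliqueFamily G),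
        (Φ T F).1.edgeSet =
          {e | e ∈ (CliqueTree.contractionGraph F).edgeSet ∧
            CliqueTree.label F e ∈ T.1.edgeSet}) ∧
      (∀ S : (∀ F : CliqueTree.CliqueFamily G,
          CliqueTree.SpanningTree (CliqueTree.contractionGraph F)),
        (Φ.symm S).1.edgeSet =
          ⋃ F : CliqueTree.CliqueFamily G, CliqueTree.label F '' (S F).1.edgeSet) := by
  exact ⟨CliqueTree.mem_edgeSet_cliqueGraph_iff, CliqueTree.splitEquiv hchordal,
    fun _ _ => rfl, fun S => CliqueTree.edgeSet_union S⟩
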